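/- **Theorem (three-timescale stochastic approximation).** Let $f:\mathbb{R}^{d}\times\mathbb{R}^{k}\times\mathbb{R}^{p}\to\mathbb{R}^d$ and $g:\mathbb{R}^{d}\times\mathbb{R}^{k}\times\mathbb{R}^{p}\to\mathbb{R}^k$ be Lipschitz and let $h:\mathbb{R}^{d}\times\mathbb{R}^{k}\times\mathbb{R}^{p}\to\mathbb{R}^p$ be continuous with at most linear growth, $\|h(u)\|\le C(1+\|u\|)$ for some constant $C$ (for instance $h$ Lipschitz, or $h$ bounded and continuous). On a probability space with a filtration $(\mathcal{F}_n)$ let $(x_n),(y_n),(z_n)$, $n\ge 0$, satisfy almost surely $$\begin{aligned} x_{n+1}&=x_n+a_n\big[f(x_n,y_n,z_n)+M^{(1)}_{n+1}\big],\\ y_{n+1}&=y_n+b_n\big[g(x_n,y_n,z_n)+M^{(2)}_{n+1}\big],\\ z_{n+1}&=z_n+c_n\big[h(x_n,y_n,z_n)+M^{(3)}_{n+1}\big]. \end{aligned}$$ Assume: 1. The stepsizes are positive, $\sum_n a_n=\sum_n b_n=\sum_n c_n=\infty$, $\sum_n(a_n^2+b_n^2+c_n^2)<\infty$, $b_n=o(a_n)$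 and $c_n=o(b_n)$. 2. For $i=1,2,3$, $(M^{(i)}_n)_{n\ge1}$ is a martingale difference sequence with respect to $(\mathcal{F}_n)_{n\ge 1}$, and there is a constant $K$ such that, almost surely for all $n\ge1$ and $i=1,2,3$, $\mathbb{E}\big[\|M^{(i)}_{n+1}\|^2\,\big|\,\mathcal{F}_n\big]\le K\big(1+\|x_n\|^2+\|y_n\|^2+\|z_n\|^2\big)$. 3. $\sup_n(\|x_n\|+\|y_n\|+\|z_n\|)<\infty$ almost surely. 4. For all $y\in\mathbb{R}^k$ and $z\in\mathbb{R}^p$, the ODE $\dot u(t)=f(u(t),y,z)$ has the globally asymptotically stable equilibrium $\lambda_1(y,z)$, where $\lambda_1:\mathbb{R}^k\times\mathbb{R}^p\to\mathbb{R}^d$ is Lipschitz. 5. For all $z\in\mathbb{R}^p$, the ODE $\dot v(t)=g(\lambda_1(v(t),z),v(t),z)$ has the globally asymptotically stable equilibrium $\lambda_2(z)$, where $\lambda_2:\mathbb{R}^p\to\mathbb{R}^k$ is Lipschitz. 6. The ODE $\dot w(t)=h\big(\lambda_1(\lambda_2(w(t)),w(t)),\lambda_2(w(t)),w(t)\big)$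 has the globally asymptotically stable equilibrium $z^\star$. Here a globally asymptotically stable equilibrium is a zero of the vector field that is Lyapunov stable and to which every solution on $[0,\infty)$ converges. Then, almost surely, $$(x_n,y_n,z_n)\longrightarrow\big(\lambda_1(\lambda_2(z^\star),z^\star),\ \lambda_2(z^\star),\ z^\star\big)\qquad(n\to\infty).$$ -/

import Mathlib

open MeasureTheory Filter Topology

/-- `p` is a globally asymptotically stable equilibrium of the autonomous differential equation
`u'(t) = F (u(t))`: it is a zero of `F`, it is Lyapunov stable, and every forward solution
converges to it. -/
structure IsGloballyAsymptoticallyStable {E : Type*} [NormedAddCommGroup E] [NormedSpace ℝ E]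
    (F : E → E) (p : E) : Prop where
  equilibrium : F p = 0
  stable : ∀ ε > 0, ∃ δ > 0, ∀ u : ℝ → E, IsIntegralCurveOn u (fun _ => F) (Set.Ici 0) →
    ‖u 0 - p‖ < δ → ∀ t ≥ 0, ‖u t - p‖ < ε
  attractive : ∀ u : ℝ → E, IsIntegralCurveOn u (fun _ => F) (Set.Ici 0) →
    Tendsto u atTop (𝓝 p)

/-- `M 1, M 2, …` is a martingale difference sequence with respect to the filtration `ℱ`
(the value `M 0` plays no role). -/
structure IsMartingaleDifference {Ω : Type*} {mΩ : MeasurableSpace Ω} {E : Type*}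
    [NormedAddCommGroup E] [NormedSpace ℝ E] [CompleteSpace E]
    (M : ℕ → Ω → E) (ℱ : Filtration ℕ mΩ) (μ : Measure Ω) : Prop where
  stronglyMeasurable : ∀ n ≥ 1, StronglyMeasurable[ℱ n] (M n)
  integrable : ∀ n ≥ 1, Integrable (M n) μ
  condExp_eq_zero : ∀ n ≥ 1, μ[M (n + 1) | ℱ n] =ᵐ[μ] 0

/-- `E[‖M (n+1)‖² | ℱ n] ≤ K (1 + ‖x n‖² + ‖y n‖² + ‖z n‖²)` almost surely for `n ≥ 1`. The
conditional expectation is the `[0, ∞]`-valued one of a nonnegative random variable, so that the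
bound has its full meaning without assuming that `‖M (n+1)‖²` is integrable. -/
def HasConditionalVarianceBound {Ω : Type*} {mΩ : MeasurableSpace Ω} {E X Y Z : Type*}
    [NormedAddCommGroup E] [NormedAddCommGroup X] [NormedAddCommGroup Y] [NormedAddCommGroup Z]
    (M : ℕ → Ω → E) (ℱ : Filtration ℕ mΩ) (μ : Measure Ω) (K : ℝ)
    (x : ℕ → Ω → X) (y : ℕ → Ω → Y) (z : ℕ → Ω → Z) : Prop :=
  ∀ n ≥ 1, ∀ᵐ ω ∂μ, condLExp (ℱ n) μ (fun ω' => ENNReal.ofReal (‖M (n + 1) ω'‖ ^ 2)) ω ≤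
    ENNReal.ofReal (K * (1 + ‖x n ω‖ ^ 2 + ‖y n ω‖ ^ 2 + ‖z n ω‖ ^ 2))

/-! The argument is pathwise once the noise is under control. Along almost every path the
conditional variances are bounded, so after localisation the weighted noise series converge by
L²-martingale convergence (`ae_exists_tendsto_noise`). Adding the tail of such a series to the
iterate turns the recursion into a noise-free Euler scheme with asymptotically the same drift.

For a bounded scheme of this kind, every cluster point lies on a bounded solution of the limiting
equation defined for all real times (`exists_entire_solution_of_noisy_recursion`). A globally
asymptotically stable equilibrium is the only bounded entire solution
(`IsGloballyAsymptoticallyStable.eq_of_bounded_entire`), which needs neither a Lyapunov function nor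
uniqueness of solutions.

Measured on a fast clock, slower variables have vanishing drift, so they are constant along limiting
solutions and the fast variable must sit at its frozen equilibrium
(`tendsto_sub_equilibrium_of_recursion`). Using this on the three clocks in turn, each time feeding
the previous tracking error into the drift as a vanishing bias, gives the limit. -/

section LimitTrajectories

/-! ### Entire solutions as limits of approximate trajectories -/

variable {E : Type*} [NormedAddCommGroup E] [NormedSpace ℝ E]

/-- A curve that is uniformly well approximated by its forward Euler steps solves the differential
equation. -/
theorem hasDerivAt_of_forward_euler {F : E → E} (hF : Continuous F) {v : ℝ → E}
    (hv : ∀ η > 0, ∃ δ > 0, ∀ s t : ℝ, s ≤ t → t - s < δ →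
      ‖v t - v s - (t - s) • F (v s)‖ ≤ η * (t - s))
    {C : ℝ} (hC : ∀ t, ‖F (v t)‖ ≤ C) (t : ℝ) : HasDerivAt v (F (v t)) t := by
  have hcont : Continuous v := by
    obtain ⟨δ, hδ, h⟩ := hv 1 one_pos
    have key : ∀ s t : ℝ, s ≤ t → t - s < δ → ‖v t - v s‖ ≤ (1 + C) * (t - s) := by
      intro s t hst hd
      calc ‖v t - v s‖ = ‖(v t - v s - (t - s) • F (v s)) + (t - s) • F (v s)‖ := by
            rw [sub_add_cancel]
        _ ≤ 1 * (t - s) + (t - s) * C := by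
            refine (norm_add_le _ _).trans (add_le_add (h s t hst hd) ?_)
            rw [norm_smul, Real.norm_of_nonneg (sub_nonneg.2 hst)]
            exact mul_le_mul_of_nonneg_left (hC s) (sub_nonneg.2 hst)
        _ = (1 + C) * (t - s) := by ring
    rw [continuous_iff_continuousAt]
    intro s
    rw [ContinuousAt, tendsto_iff_norm_sub_tendsto_zero]
    have hlim : Tendsto (fun t : ℝ => (1 + C) * |t - s|) (𝓝 s) (𝓝 0) := by
      have : Continuous fun t : ℝ => (1 + C) * |t - s| := by fun_prop
      simpa using this.tendsto s
    refine squeeze_zero' (Eventually.of_forall fun _ => norm_nonneg _) ?_ hlim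
    filter_upwards [Metric.ball_mem_nhds s hδ] with t ht
    rw [Metric.mem_ball, Real.dist_eq] at ht
    rcases le_total s t with hst | hst
    · rw [abs_of_nonneg (sub_nonneg.2 hst)] at ht ⊢
      exact key s t hst ht
    · rw [abs_of_nonpos (sub_nonpos.2 hst), neg_sub] at ht ⊢
      rw [norm_sub_rev]
      exact key t s hst ht
  rw [hasDerivAt_iff_isLittleO, Asymptotics.isLittleO_iff]
  intro η hη
  obtain ⟨δ, hδ, h⟩ := hv (η / 2) (half_pos hη)
  have hFv : ∀ᶠ r in 𝓝 t, ‖F (v r) - F (v t)‖ < η / 2 := by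
    have := (hF.comp hcont).tendsto t
    rw [tendsto_iff_norm_sub_tendsto_zero] at this
    exact this.eventually_lt_const (half_pos hη)
  filter_upwards [Metric.ball_mem_nhds t hδ, hFv] with r hr hFr
  rw [Metric.mem_ball, Real.dist_eq] at hr
  rw [Real.norm_eq_abs]
  rcases le_total t r with htr | htr
  · rw [abs_of_nonneg (sub_nonneg.2 htr)] at hr ⊢
    have := h t r htr hr
    nlinarith [sub_nonneg.2 htr]
  · rw [abs_of_nonpos (sub_nonpos.2 htr), neg_sub] at hr ⊢
    -- The Euler step starts at the earlier time `r`, so `F (v r)` must be exchanged for `F (v t)`;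
    -- this costs the other `η / 2`.
    have h1 := h r t htr hr
    have h2 : v r - v t - (r - t) • F (v t)
        = -(v t - v r - (t - r) • F (v r)) - (t - r) • (F (v r) - F (v t)) := by
      module
    rw [h2]
    refine (norm_sub_le _ _).trans ?_
    rw [norm_neg, norm_smul, Real.norm_of_nonneg (sub_nonneg.2 htr)]
    nlinarith [sub_nonneg.2 htr, mul_le_mul_of_nonneg_left hFr.le (sub_nonneg.2 htr)]

variable [ProperSpace E]

/-- Pointwise limits, along an ultrafilter, of bounded curves whose forward Euler errors vanish
asymptotically are entire solutions of the differential equation. -/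
theorem exists_entire_solution_of_asymptotic {F : E → E} (hF : Continuous F)
    (U : Ultrafilter ℕ) {R : ℝ} {w : ℕ → ℝ → E} (hb : ∀ j t, ‖w j t‖ ≤ R)
    (hw : ∀ η > 0, ∃ δ > 0, ∀ s t : ℝ, s ≤ t → t - s < δ →
      ∃ θ : ℕ → ℝ, Tendsto θ U (𝓝 (t - s)) ∧
        ∀ᶠ j in (U : Filter ℕ), ‖w j t - w j s - θ j • F (w j s)‖ ≤ η * θ j) :
    ∃ v : ℝ → E, (∀ t, Tendsto (fun j => w j t) U (𝓝 (v t))) ∧ (∀ t, ‖v t‖ ≤ R) ∧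
      ∀ t, HasDerivAt v (F (v t)) t := by
  have hK : IsCompact (Metric.closedBall (0 : E) R) := isCompact_closedBall 0 R
  -- The ultrafilter yields limits at all times at once. The curves `w j` may jump; continuity of
  -- the limit comes from the Euler estimate rather than from equicontinuity.
  have hex : ∀ t, ∃ x ∈ Metric.closedBall (0 : E) R, Tendsto (fun j => w j t) U (𝓝 x) := by
    intro t
    have := hK.ultrafilter_le_nhds (U.map fun j => w j t) (by
      rw [Ultrafilter.coe_map, le_principal_iff, mem_map]
      exact Eventually.of_forall fun j => by simpa using hb j t)
    simpa [Tendsto] using this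
  choose v hvR hv using hex
  have hvR' : ∀ t, ‖v t‖ ≤ R := fun t => by simpa using hvR t
  obtain ⟨C, hC⟩ := hK.exists_bound_of_continuousOn hF.continuousOn
  refine ⟨v, hv, hvR', fun t => hasDerivAt_of_forward_euler hF ?_ (fun t => hC _ (hvR t)) t⟩
  intro η hη
  obtain ⟨δ, hδ, h⟩ := hw η hη
  refine ⟨δ, hδ, fun s t hst hd => ?_⟩
  obtain ⟨θ, hθ, hle⟩ := h s t hst hd
  refine le_of_tendsto_of_tendsto ?_ (hθ.const_mul η) hle
  exact (((hv t).sub (hv s)).sub (hθ.smul ((hF.tendsto _).comp (hv s)))).norm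

/-- Bounded entire solutions have uniformly small forward Euler errors. -/
theorem forward_euler_of_bounded_solution {F : E → E} (hF : Continuous F) {v : ℝ → E} {R : ℝ}
    (hR : ∀ t, ‖v t‖ ≤ R) (hv : ∀ t, HasDerivAt v (F (v t)) t) :
    ∀ η > 0, ∃ δ > 0, ∀ s t : ℝ, s ≤ t → t - s < δ →
      ‖v t - v s - (t - s) • F (v s)‖ ≤ η * (t - s) := by
  intro η hη
  have hK : IsCompact (Metric.closedBall (0 : E) R) := isCompact_closedBall 0 R
  have hvK : ∀ t, v t ∈ Metric.closedBall (0 : E) R := fun t => by simpa using hR t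
  obtain ⟨C, hC⟩ := hK.exists_bound_of_continuousOn hF.continuousOn
  have huc := hK.uniformContinuousOn_of_continuous hF.continuousOn
  obtain ⟨ρ, hρ, huc⟩ := Metric.uniformContinuousOn_iff.1 huc η hη
  have hC0 : 0 ≤ C := (norm_nonneg _).trans (hC _ (hvK 0))
  -- `v` is `C`-Lipschitz, so in this time it moves less than `ρ`; the `+ 1` covers `C = 0`.
  refine ⟨ρ / (C + 1), by positivity, fun s t hst hd => ?_⟩
  have hlip : ∀ r, ‖v r - v s‖ ≤ C * ‖r - s‖ := fun r =>
    Convex.norm_image_sub_le_of_norm_hasDerivWithin_le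
      (fun x _ => (hv x).hasDerivWithinAt) (fun x _ => hC _ (hvK x)) convex_univ
      (Set.mem_univ s) (Set.mem_univ r)
  have := Convex.norm_image_sub_le_of_norm_hasDerivWithin_le (s := Set.Icc s t) (C := η)
    (f := fun r => v r - r • F (v s)) (f' := fun r => F (v r) - (1 : ℝ) • F (v s))
    (fun r _ => ((hv r).sub ((hasDerivAt_id r).smul_const (F (v s)))).hasDerivWithinAt)
    (fun r hr => by
      rw [one_smul, ← dist_eq_norm]
      refine (huc _ (hvK r) _ (hvK s) ?_).le
      rw [dist_eq_norm]
      refine (hlip r).trans_lt ?_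
      rw [Real.norm_of_nonneg (sub_nonneg.2 hr.1)]
      rw [lt_div_iff₀ (by positivity)] at hd
      nlinarith [hr.1, hr.2])
    (convex_Icc s t) (Set.left_mem_Icc.2 hst) (Set.right_mem_Icc.2 hst)
  rw [Real.norm_of_nonneg (sub_nonneg.2 hst)] at this
  convert this using 2
  module

/-- The only bounded entire solution of an equation with a globally asymptotically stable
equilibrium is the equilibrium itself. -/
theorem IsGloballyAsymptoticallyStable.eq_of_bounded_entire {F : E → E} (hF : Continuous F) {p : E}
    (hp : IsGloballyAsymptoticallyStable F p) {v : ℝ → E} {R : ℝ} (hR : ∀ t, ‖v t‖ ≤ R)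
    (hv : ∀ t, HasDerivAt v (F (v t)) t) : v 0 = p := by
  by_contra hne
  have hshift : ∀ r t : ℝ, HasDerivAt (fun τ => v (τ + r)) (F (v (t + r))) t := fun r t =>
    HasDerivAt.comp_add_const t r (hv (t + r))
  obtain ⟨δ, hδ, hstab⟩ := hp.stable ‖v 0 - p‖ (norm_pos_iff.2 (sub_ne_zero.2 hne))
  -- By stability, a solution that was once `δ`-close to `p` could not be as far away as `v 0` at
  -- time `0`. Limits of the translates of `v` into the past are then solutions that stay away from
  -- `p` forever, against attractivity.
  have hfar : ∀ t ≤ 0, δ ≤ ‖v t - p‖ := by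
    intro t ht
    by_contra! hlt
    have := hstab (fun τ => v (τ + t)) (fun τ _ => (hshift t τ).hasDerivWithinAt)
      (by simpa using hlt) (-t) (by linarith)
    simp at this
  obtain ⟨w, hw, -, hwd⟩ := exists_entire_solution_of_asymptotic hF (hyperfilter ℕ)
    (w := fun j t => v (t + -(j : ℝ))) (R := R) (fun j t => hR _) (by
      intro η hη
      obtain ⟨δ, hδ, h⟩ := forward_euler_of_bounded_solution hF hR hv η hη
      refine ⟨δ, hδ, fun s t hst hd => ⟨fun _ => t - s, tendsto_const_nhds,
        Eventually.of_forall fun j => ?_⟩⟩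
      have := h (s + -(j : ℝ)) (t + -(j : ℝ)) (by linarith) (by linarith)
      rwa [add_sub_add_right_eq_sub] at this)
  have hwfar : ∀ t, δ ≤ ‖w t - p‖ := by
    intro t
    refine ge_of_tendsto ((hw t).sub_const p).norm ?_
    have : ∀ᶠ j : ℕ in atTop, t ≤ j := tendsto_natCast_atTop_atTop.eventually_ge_atTop t
    filter_upwards [Nat.hyperfilter_le_atTop this] with j hj
    exact hfar _ (by linarith)
  have hlim := hp.attractive w fun t _ => (hwd t).hasDerivWithinAt
  have := ge_of_tendsto (hlim.sub_const p).norm (Eventually.of_forall hwfar)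
  simp at this
  linarith

end LimitTrajectories

/-- A continuous function takes asymptotically equal values along bounded asymptotically equal
sequences. -/
theorem tendsto_map_sub_map_of_bounded {E E' : Type*} [NormedAddCommGroup E] [ProperSpace E]
    [NormedAddCommGroup E'] {F : E → E'} (hF : Continuous F) {u w : ℕ → E} {R : ℝ}
    (hu : ∀ n, ‖u n‖ ≤ R) (huw : Tendsto (fun n => u n - w n) atTop (𝓝 0)) :
    Tendsto (fun n => F (u n) - F (w n)) atTop (𝓝 0) := by
  obtain ⟨B, hB⟩ := huw.norm.bddAbove_range
  have hdiff : ∀ n, ‖u n - w n‖ ≤ B := fun n => hB (Set.mem_range_self n)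
  have hB0 : 0 ≤ B := (norm_nonneg _).trans (hdiff 0)
  have hw : ∀ n, ‖w n‖ ≤ R + B := fun n => by
    have := norm_sub_le (u n) (u n - w n)
    rw [sub_sub_cancel] at this
    linarith [hu n, hdiff n]
  have huc := (isCompact_closedBall (0 : E) (R + B)).uniformContinuousOn_of_continuous
    hF.continuousOn
  rw [Metric.tendsto_atTop]
  intro ε hε
  obtain ⟨ρ, hρ, huc⟩ := Metric.uniformContinuousOn_iff.1 huc ε hε
  obtain ⟨n₀, hn₀⟩ := Metric.tendsto_atTop.1 huw ρ hρ
  refine ⟨n₀, fun n hn => ?_⟩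
  have := huc (u n) (by simpa using (hu n).trans (by linarith)) (w n) (by simpa using hw n)
    (by simpa [dist_eq_norm] using hn₀ n hn)
  simpa [dist_eq_norm] using this

/-! ### Bounded recursions and their limiting equations -/

section Recursions

/-- The largest index whose partial sum does not exceed a given time. -/
theorem exists_index_of_partial_sums {s : ℕ → ℝ} (hs : ∀ n, 0 < s n)
    (hs0 : Tendsto s atTop (𝓝 0))
    (hsum : Tendsto (fun n => ∑ i ∈ Finset.range n, s i) atTop atTop) :
    ∃ N : ℝ → ℕ, Monotone N ∧ Tendsto N atTop atTop ∧
      (∀ n, N (∑ i ∈ Finset.range n, s i) = n) ∧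
      Tendsto (fun τ => (∑ i ∈ Finset.range (N τ), s i) - τ) atTop (𝓝 0) := by
  classical
  set T : ℕ → ℝ := fun n => ∑ i ∈ Finset.range n, s i with hT
  have hTmono : StrictMono T := strictMono_nat_of_lt_succ fun n => by
    simp only [hT, Finset.sum_range_succ]
    linarith [hs n]
  have hex : ∀ τ : ℝ, ∃ n, τ < T (n + 1) := fun τ =>
    ((hsum.comp (tendsto_add_atTop_nat 1)).eventually_gt_atTop τ).exists
  let N : ℝ → ℕ := fun τ => Nat.find (hex τ)
  have hN : ∀ τ, τ < T (N τ + 1) := fun τ => Nat.find_spec (hex τ)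
  -- For `τ < 0` this fails, since `N τ = 0` and `T 0 = 0`.
  have hN' : ∀ τ, 0 ≤ τ → T (N τ) ≤ τ := by
    intro τ hτ
    rcases Nat.eq_zero_or_pos (N τ) with h0 | hpos
    · rw [h0]
      simpa [hT] using hτ
    · have := Nat.find_min (hex τ) (m := N τ - 1) (Nat.sub_lt hpos one_pos)
      rw [show N τ - 1 + 1 = N τ by omega] at this
      exact not_lt.1 this
  have hmono : Monotone N := fun σ τ hστ => Nat.find_min' (hex σ) (hστ.trans_lt (hN τ))
  have hNT : ∀ n, N (T n) = n := by
    intro n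
    have h0 : 0 ≤ T n := Finset.sum_nonneg fun i _ => (hs i).le
    have h1 := hTmono.lt_iff_lt.1 (hN (T n))
    have h2 := hTmono.le_iff_le.1 (hN' (T n) h0)
    omega
  have htop : Tendsto N atTop atTop :=
    tendsto_atTop_atTop.2 fun n => ⟨T n, fun τ hτ => (hNT n).symm.le.trans (hmono hτ)⟩
  refine ⟨N, hmono, htop, hNT, ?_⟩
  have hlim : Tendsto (fun τ => -s (N τ)) atTop (𝓝 0) := by simpa using (hs0.comp htop).neg
  refine tendsto_of_tendsto_of_tendsto_of_le_of_le' hlim tendsto_const_nhds ?_ ?_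
  · refine Eventually.of_forall fun τ => ?_
    have := hN τ
    simp only [hT, Finset.sum_range_succ] at this
    linarith
  · filter_upwards [eventually_ge_atTop 0] with τ hτ
    linarith [hN' τ hτ]

variable {E : Type*} [NormedAddCommGroup E] [NormedSpace ℝ E] [ProperSpace E]

/-- Forward Euler estimate over many steps for a bounded recursion with asymptotic drift `F`. -/
theorem forward_euler_of_recursion {F : E → E} (hF : Continuous F) {s : ℕ → ℝ}
    (hs : ∀ n, 0 < s n) {w G : ℕ → E} (hw : ∀ n, w (n + 1) = w n + s n • G n)
    (hG : Tendsto (fun n => G n - F (w n)) atTop (𝓝 0)) {R : ℝ} (hR : ∀ n, ‖w n‖ ≤ R) :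
    ∀ η > 0, ∃ δ > 0, ∃ n₀ : ℕ, ∀ m n : ℕ, n₀ ≤ m → m ≤ n →
      (∑ i ∈ Finset.range n, s i) - ∑ i ∈ Finset.range m, s i < δ →
      ‖w n - w m - ((∑ i ∈ Finset.range n, s i) - ∑ i ∈ Finset.range m, s i) • F (w m)‖
        ≤ η * ((∑ i ∈ Finset.range n, s i) - ∑ i ∈ Finset.range m, s i) := by
  intro η hη
  have hK : IsCompact (Metric.closedBall (0 : E) R) := isCompact_closedBall 0 R
  have hwK : ∀ t, w t ∈ Metric.closedBall (0 : E) R := fun t => by simpa using hR t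
  obtain ⟨C, hC⟩ := hK.exists_bound_of_continuousOn hF.continuousOn
  have hC0 : 0 ≤ C := (norm_nonneg _).trans (hC _ (hwK 0))
  have huc := hK.uniformContinuousOn_of_continuous hF.continuousOn
  obtain ⟨ρ, hρ, huc⟩ := Metric.uniformContinuousOn_iff.1 huc (η / 2) (half_pos hη)
  -- The bound `1` gives `‖G n‖ ≤ C + 1`, which controls displacement; `η / 2` is the drift error,
  -- the other half being the oscillation of `F`.
  have hG' : ∀ᶠ n in atTop, ‖G n - F (w n)‖ < min 1 (η / 2) := by
    have := hG.norm
    rw [norm_zero] at this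
    exact this.eventually_lt_const (by positivity)
  obtain ⟨n₀, hn₀⟩ := eventually_atTop.1 hG'
  refine ⟨ρ / (C + 1), by positivity, n₀, fun m n hm hmn => ?_⟩
  have hlip : ∀ n, m ≤ n → ‖w n - w m‖
      ≤ (C + 1) * ((∑ i ∈ Finset.range n, s i) - ∑ i ∈ Finset.range m, s i) := by
    intro n hmn
    induction n, hmn using Nat.le_induction with
    | base => simp
    | succ n hmn ih =>
      have hGn : ‖G n‖ ≤ C + 1 := by
        have h1 := (hn₀ n (hm.trans hmn)).le.trans (min_le_left _ _)
        have h2 := hC _ (hwK n)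
        have h3 := norm_add_le (G n - F (w n)) (F (w n))
        rw [sub_add_cancel] at h3
        linarith
      rw [hw, Finset.sum_range_succ, add_sub_right_comm]
      refine (norm_add_le _ _).trans ?_
      rw [norm_smul, Real.norm_of_nonneg (hs n).le]
      nlinarith [mul_le_mul_of_nonneg_left hGn (hs n).le]
  induction n, hmn using Nat.le_induction with
  | base => simp
  | succ n hmn ih =>
    intro hδ
    rw [Finset.sum_range_succ] at hδ ⊢
    have hδ' : (∑ i ∈ Finset.range n, s i) - ∑ i ∈ Finset.range m, s i < ρ / (C + 1) := by
      linarith [hs n]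
    have ih := ih hδ'
    have hnear : ‖F (w n) - F (w m)‖ < η / 2 := by
      rw [← dist_eq_norm]
      refine huc _ (hwK n) _ (hwK m) ?_
      rw [dist_eq_norm]
      refine (hlip n hmn).trans_lt ?_
      rwa [lt_div_iff₀ (by positivity), mul_comm] at hδ'
    have hGn : ‖G n - F (w m)‖ ≤ η := by
      have h1 := (hn₀ n (hm.trans hmn)).le.trans (min_le_right _ _)
      have h3 := norm_add_le (G n - F (w n)) (F (w n) - F (w m))
      rw [sub_add_sub_cancel] at h3
      linarith
    set Tn := ∑ i ∈ Finset.range n, s i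
    set Tm := ∑ i ∈ Finset.range m, s i
    have heq : w (n + 1) - w m - (Tn + s n - Tm) • F (w m)
        = (w n - w m - (Tn - Tm) • F (w m)) + s n • (G n - F (w m)) := by
      rw [hw]
      module
    rw [heq]
    refine (norm_add_le _ _).trans ?_
    rw [norm_smul, Real.norm_of_nonneg (hs n).le]
    nlinarith [mul_le_mul_of_nonneg_left hGn (hs n).le]

/-- Every cluster point of a bounded recursion with asymptotic drift `F` lies on a bounded entire
solution of `u' = F u`. -/
theorem exists_entire_solution_of_recursion {F : E → E} (hF : Continuous F) {s : ℕ → ℝ}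
    (hs : ∀ n, 0 < s n) (hs0 : Tendsto s atTop (𝓝 0))
    (hsum : Tendsto (fun n => ∑ i ∈ Finset.range n, s i) atTop atTop)
    {w G : ℕ → E} (hw : ∀ n, w (n + 1) = w n + s n • G n)
    (hG : Tendsto (fun n => G n - F (w n)) atTop (𝓝 0)) {R : ℝ} (hR : ∀ n, ‖w n‖ ≤ R)
    {φ : ℕ → ℕ} (hφ : Tendsto φ atTop atTop) {q : E} (hq : Tendsto (w ∘ φ) atTop (𝓝 q)) :
    ∃ v : ℝ → E, v 0 = q ∧ (∀ t, ‖v t‖ ≤ R) ∧ ∀ t, HasDerivAt v (F (v t)) t := by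
  obtain ⟨N, hmono, htop, hNT, hlim⟩ := exists_index_of_partial_sums hs hs0 hsum
  set T : ℕ → ℝ := fun n => ∑ i ∈ Finset.range n, s i with hT
  have hU : ((hyperfilter ℕ : Ultrafilter ℕ) : Filter ℕ) ≤ atTop := Nat.hyperfilter_le_atTop
  have htime : ∀ t : ℝ, Tendsto (fun j => T (φ j) + t) atTop atTop := fun t =>
    tendsto_atTop_add_const_right _ t (hsum.comp hφ)
  -- Piecewise constant interpolation with the time origin moved to `T (φ j)`, so that time `0` sees
  -- exactly `w (φ j)`. The time elapsed on the grid differs from `b - a` by a null sequence.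
  obtain ⟨v, hv, hvR, hvd⟩ := exists_entire_solution_of_asymptotic hF (hyperfilter ℕ)
    (w := fun j t => w (N (T (φ j) + t))) (R := R) (fun j t => hR _) (by
      intro η hη
      obtain ⟨δ, hδ, n₀, h⟩ := forward_euler_of_recursion hF hs hw hG hR η hη
      refine ⟨δ, hδ, fun a b hab hd =>
        ⟨fun j => T (N (T (φ j) + b)) - T (N (T (φ j) + a)), ?_⟩⟩
      have hθ : Tendsto (fun j => T (N (T (φ j) + b)) - T (N (T (φ j) + a))) atTop
          (𝓝 (b - a)) := by
        have := ((hlim.comp (htime b)).sub (hlim.comp (htime a))).add_const (b - a)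
        simp only [sub_zero, zero_add] at this
        refine this.congr fun j => ?_
        simp only [Function.comp, hT]
        ring
      refine ⟨hθ.mono_left hU, hU ?_⟩
      filter_upwards [hθ.eventually_lt_const hd,
        (htop.comp (htime a)).eventually_ge_atTop n₀] with j hj hj'
      exact h _ _ hj' (hmono (by linarith)) hj)
  refine ⟨v, ?_, hvR, hvd⟩
  refine tendsto_nhds_unique (hv 0) ?_
  simp only [add_zero, hT, hNT]
  exact hq.mono_left hU

/-- Cluster points of a bounded stochastic approximation recursion with vanishing bias and
summable noise lie on bounded entire solutions of the limiting differential equation. -/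
theorem exists_entire_solution_of_noisy_recursion {F : E → E} (hF : Continuous F) {s : ℕ → ℝ}
    (hs : ∀ n, 0 < s n) (hs0 : Tendsto s atTop (𝓝 0))
    (hsum : Tendsto (fun n => ∑ i ∈ Finset.range n, s i) atTop atTop)
    {u e m : ℕ → E} (hu : ∀ n, u (n + 1) = u n + s n • (F (u n) + e n) + m n)
    (he : Tendsto e atTop (𝓝 0))
    (hm : ∃ l, Tendsto (fun n => ∑ i ∈ Finset.range n, m i) atTop (𝓝 l))
    {R : ℝ} (hR : ∀ n, ‖u n‖ ≤ R)
    {φ : ℕ → ℕ} (hφ : Tendsto φ atTop atTop) {q : E} (hq : Tendsto (u ∘ φ) atTop (𝓝 q)) :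
    ∃ (v : ℝ → E) (R' : ℝ), v 0 = q ∧ (∀ t, ‖v t‖ ≤ R') ∧ ∀ t, HasDerivAt v (F (v t)) t := by
  obtain ⟨l, hl⟩ := hm
  -- The tail of the noise: `u + r` obeys a recursion without noise and has the same cluster points
  -- as `u`.
  set r : ℕ → E := fun n => l - ∑ i ∈ Finset.range n, m i with hr
  have hr0 : Tendsto r atTop (𝓝 0) := by simpa using hl.const_sub l
  obtain ⟨B, hB⟩ := hr0.norm.bddAbove_range
  have hrB : ∀ n, ‖r n‖ ≤ B := fun n => hB (Set.mem_range_self n)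
  have hR' : ∀ n, ‖u n + r n‖ ≤ R + B := fun n =>
    (norm_add_le _ _).trans (add_le_add (hR n) (hrB n))
  have hdiff : Tendsto (fun n => F (u n) - F (u n + r n)) atTop (𝓝 0) :=
    tendsto_map_sub_map_of_bounded hF hR (by simpa using hr0.neg)
  obtain ⟨v, hv⟩ := exists_entire_solution_of_recursion hF hs hs0 hsum
    (w := fun n => u n + r n) (G := fun n => F (u n) + e n) (fun n => by
      simp only [hr, hu, Finset.sum_range_succ]
      module) (by
      refine (by simpa using hdiff.add he : Tendsto _ atTop (𝓝 (0 : E))).congr fun n => ?_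
      abel) hR' hφ (q := q)
      (by simpa [Function.comp_def] using hq.add (hr0.comp hφ))
  exact ⟨v, R + B, hv⟩

end Recursions

/-- A bounded sequence is mapped to a null sequence by a continuous function that vanishes at all
its cluster points. -/
theorem tendsto_zero_of_clusterPts {E E' : Type*} [NormedAddCommGroup E]
    [ProperSpace E] [NormedAddCommGroup E'] {Φ : E → E'}
    (hΦ : Continuous Φ) {u : ℕ → E} {R : ℝ} (hR : ∀ n, ‖u n‖ ≤ R)
    (h : ∀ (φ : ℕ → ℕ) (q : E), Tendsto φ atTop atTop → Tendsto (u ∘ φ) atTop (𝓝 q) → Φ q = 0) :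
    Tendsto (fun n => Φ (u n)) atTop (𝓝 0) := by
  refine tendsto_of_subseq_tendsto fun ns hns => ?_
  obtain ⟨q, -, ψ, hψ, hq⟩ := (isCompact_closedBall (0 : E) R).tendsto_subseq
    (x := u ∘ ns) fun n => by simpa using hR (ns n)
  refine ⟨ψ, ?_⟩
  rw [← h (ns ∘ ψ) q (hns.comp hψ.tendsto_atTop) hq]
  exact (hΦ.tendsto q).comp hq

/-! ### Almost sure convergence of the accumulated noise -/

section MartingaleNoise

variable {Ω : Type*} {mΩ : MeasurableSpace Ω} {μ : Measure Ω} [IsProbabilityMeasure μ]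

/-- A series of square-integrable martingale increments with summable variances converges almost
surely. -/
theorem ae_exists_tendsto_sum_of_summable_variance {𝒢 : Filtration ℕ mΩ} {ξ : ℕ → Ω → ℝ}
    (hmeas : ∀ n, StronglyMeasurable[𝒢 (n + 1)] (ξ n)) (hL2 : ∀ n, MemLp (ξ n) 2 μ)
    (hce : ∀ n, μ[ξ n | 𝒢 n] =ᵐ[μ] 0) (hvar : Summable fun n => ∫ ω, ξ n ω ^ 2 ∂μ) :
    ∀ᵐ ω ∂μ, ∃ l, Tendsto (fun n => ∑ i ∈ Finset.range n, ξ i ω) atTop (𝓝 l) := by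
  set S : ℕ → Ω → ℝ := fun n ω => ∑ i ∈ Finset.range n, ξ i ω with hS
  have hSsucc : ∀ n, S (n + 1) = S n + ξ n := fun n => by
    ext ω
    simp [hS, Finset.sum_range_succ]
  have hadp : StronglyAdapted 𝒢 S := fun n =>
    Finset.stronglyMeasurable_fun_sum _ fun i hi =>
      (hmeas i).mono (𝒢.mono (Finset.mem_range.1 hi))
  have hSL2 : ∀ n, MemLp (S n) 2 μ := fun n => memLp_finsetSum _ fun i _ => hL2 i
  have hint : ∀ n, Integrable (S n) μ := fun n => (hSL2 n).integrable (by norm_num)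
  have hmart : Martingale S 𝒢 μ := martingale_of_condExp_sub_eq_zero_nat hadp hint fun n => by
    rw [hSsucc, add_sub_cancel_left]
    exact hce n
  -- `S n` is known at time `n` and `ξ n` has conditional mean zero, so variances add up. With `|S|
  -- ≤ 1 + S²` this bounds the martingale in L¹.
  have horth : ∀ n, ∫ ω, S n ω * ξ n ω ∂μ = 0 := by
    intro n
    have hprod : Integrable (S n * ξ n) μ := (hSL2 n).integrable_mul (hL2 n)
    have h1 := condExp_mul_of_stronglyMeasurable_left (hadp n) hprod
      ((hL2 n).integrable (by norm_num))
    have h2 := integral_condExp (μ := μ) (f := S n * ξ n) (𝒢.le n)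
    rw [show ∫ ω, S n ω * ξ n ω ∂μ = ∫ ω, (S n * ξ n) ω ∂μ from rfl, ← h2]
    refine integral_eq_zero_of_ae ?_
    filter_upwards [h1, hce n] with ω hω hω'
    rw [hω, Pi.mul_apply, hω']
    simp
  have hsq : ∀ n, ∫ ω, S n ω ^ 2 ∂μ = ∑ i ∈ Finset.range n, ∫ ω, ξ i ω ^ 2 ∂μ := by
    intro n
    induction n with
    | zero => simp [hS]
    | succ n ih =>
      rw [Finset.sum_range_succ, ← ih]
      have h1 : Integrable (fun ω => S n ω ^ 2) μ := (hSL2 n).integrable_sq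
      have h2 : Integrable (fun ω => 2 * (S n ω * ξ n ω)) μ :=
        ((hSL2 n).integrable_mul (hL2 n)).const_mul 2
      have h3 : Integrable (fun ω => ξ n ω ^ 2) μ := (hL2 n).integrable_sq
      calc ∫ ω, S (n + 1) ω ^ 2 ∂μ
          = ∫ ω, (S n ω ^ 2 + 2 * (S n ω * ξ n ω)) + ξ n ω ^ 2 ∂μ := by
            refine integral_congr_ae (Eventually.of_forall fun ω => ?_)
            simp only [hSsucc, Pi.add_apply]
            ring
        _ = _ := by
            have h12 : Integrable (fun ω => S n ω ^ 2 + 2 * (S n ω * ξ n ω)) μ := h1.add h2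
            rw [integral_add h12 h3, integral_add h1 h2, integral_const_mul, horth]
            ring
  have hbdd : ∀ n, eLpNorm (S n) 1 μ ≤ (1 + ∑' i, ∫ ω, ξ i ω ^ 2 ∂μ).toNNReal := by
    intro n
    rw [eLpNorm_one_eq_lintegral_enorm, ← ofReal_integral_norm_eq_lintegral_enorm (hint n)]
    refine ENNReal.ofReal_le_ofReal ?_
    calc ∫ ω, ‖S n ω‖ ∂μ ≤ ∫ ω, 1 + S n ω ^ 2 ∂μ := by
          refine integral_mono (hint n).norm ((integrable_const 1).add (hSL2 n).integrable_sq) ?_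
          intro ω
          simp only [Real.norm_eq_abs]
          nlinarith [sq_nonneg (|S n ω| - 1), sq_abs (S n ω)]
      _ = 1 + ∑ i ∈ Finset.range n, ∫ ω, ξ i ω ^ 2 ∂μ := by
          rw [integral_add (integrable_const 1) (hSL2 n).integrable_sq, hsq]
          simp
      _ ≤ _ := by
          gcongr
          exact hvar.sum_le_tsum _ fun i _ => integral_nonneg fun ω => sq_nonneg _
  exact hmart.submartingale.exists_ae_tendsto_of_bdd hbdd

/-- A weighted series of martingale differences with almost surely bounded conditional variances
and square-summable weights converges almost surely. -/
theorem ae_exists_tendsto_sum_of_bounded_condVar {ℱ : Filtration ℕ mΩ} {D : ℕ → Ω → ℝ}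
    (hD : IsMartingaleDifference D ℱ μ) {V : ℕ → Ω → ENNReal}
    (hVm : ∀ n, Measurable[ℱ n] (V n))
    (hDV : ∀ n ≥ 1, ∀ s, MeasurableSet[ℱ n] s →
      ∫⁻ ω in s, ENNReal.ofReal (D (n + 1) ω ^ 2) ∂μ ≤ ∫⁻ ω in s, V n ω ∂μ)
    (hV : ∀ᵐ ω ∂μ, ∃ N : ℕ, ∀ n ≥ 1, V n ω ≤ N)
    {a : ℕ → ℝ} (ha : Summable fun n => a n ^ 2) :
    ∀ᵐ ω ∂μ, ∃ l, Tendsto (fun n => ∑ i ∈ Finset.range n, a i * D (i + 1) ω) atTop (𝓝 l) := by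
  -- Localisation: `A N n` is already decided at time `n + 1`, so cutting off `D (n + 2)` on it
  -- preserves conditional mean zero. On paths with `V ≤ N` nothing is cut off.
  let A : ℕ → ℕ → Set Ω := fun N n => ⋂ m ∈ Finset.Icc 1 (n + 1), {ω | V m ω ≤ N}
  have hA : ∀ N n, MeasurableSet[ℱ (n + 1)] (A N n) := fun N n =>
    Finset.measurableSet_biInter _ fun m hm =>
      ℱ.mono (Finset.mem_Icc.1 hm).2 _ (measurableSet_le (hVm m) measurable_const)
  let 𝒢 : Filtration ℕ mΩ :=
    ⟨fun n => ℱ (n + 1), fun i j hij => ℱ.mono (Nat.succ_le_succ hij), fun n => ℱ.le _⟩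
  let ξ : ℕ → ℕ → Ω → ℝ := fun N n => (A N n).indicator fun ω => a (n + 1) * D (n + 2) ω
  have hDint : ∀ n, Integrable (fun ω => a (n + 1) * D (n + 2) ω) μ := fun n =>
    (hD.integrable (n + 2) (by omega)).const_mul _
  have hsm : ∀ N n, StronglyMeasurable[𝒢 (n + 1)] (ξ N n) := fun N n =>
    ((hD.stronglyMeasurable (n + 2) (by omega)).const_mul (a (n + 1))).indicator
      (ℱ.mono (Nat.le_succ (n + 1)) _ (hA N n))
  have hsm' : ∀ N n, AEStronglyMeasurable (ξ N n) μ := fun N n =>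
    ((hsm N n).mono (𝒢.le _)).aestronglyMeasurable
  -- `D` is not assumed square integrable; this `[0, ∞]`-valued bound supplies it for the truncated
  -- increments.
  have hlint : ∀ N n, ∫⁻ ω, ENNReal.ofReal (ξ N n ω ^ 2) ∂μ
      ≤ ENNReal.ofReal (a (n + 1) ^ 2 * N) := by
    intro N n
    have hAm : MeasurableSet (A N n) := ℱ.le _ _ (hA N n)
    have hpt : (fun ω => ENNReal.ofReal (ξ N n ω ^ 2)) = (A N n).indicator fun ω =>
        ENNReal.ofReal (a (n + 1) ^ 2) * ENNReal.ofReal (D (n + 2) ω ^ 2) := by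
      ext ω
      by_cases hω : ω ∈ A N n
      · simp only [ξ, Set.indicator_of_mem hω]
        rw [mul_pow, ENNReal.ofReal_mul (sq_nonneg _)]
      · simp [ξ, Set.indicator_of_notMem hω]
    rw [hpt, lintegral_indicator hAm, lintegral_const_mul' _ _ ENNReal.ofReal_ne_top,
      ENNReal.ofReal_mul (sq_nonneg _), ENNReal.ofReal_natCast]
    gcongr
    calc ∫⁻ ω in A N n, ENNReal.ofReal (D (n + 2) ω ^ 2) ∂μ
        ≤ ∫⁻ ω in A N n, V (n + 1) ω ∂μ := hDV (n + 1) (by omega) _ (hA N n)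
      _ ≤ ∫⁻ _ in A N n, (N : ENNReal) ∂μ := by
          refine setLIntegral_mono measurable_const fun ω hω => ?_
          exact Set.mem_iInter₂.1 hω (n + 1) (Finset.mem_Icc.2 ⟨by omega, le_rfl⟩)
      _ ≤ N := by
          rw [setLIntegral_const]
          exact mul_le_of_le_one_right' prob_le_one
  have hsqint : ∀ N n, Integrable (fun ω => ξ N n ω ^ 2) μ := fun N n => by
    refine ⟨(hsm' N n).pow 2, ?_⟩
    rw [hasFiniteIntegral_iff_ofReal (Eventually.of_forall fun ω => sq_nonneg _)]
    exact (hlint N n).trans_lt ENNReal.ofReal_lt_top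
  have hL2 : ∀ N n, MemLp (ξ N n) 2 μ := fun N n =>
    (memLp_two_iff_integrable_sq (hsm' N n)).2 (hsqint N n)
  have hvar : ∀ N n, ∫ ω, ξ N n ω ^ 2 ∂μ ≤ a (n + 1) ^ 2 * N := fun N n => by
    rw [integral_eq_lintegral_of_nonneg_ae (Eventually.of_forall fun ω => sq_nonneg _)
      (hsqint N n).1]
    exact ENNReal.toReal_le_of_le_ofReal (by positivity) (hlint N n)
  have hce : ∀ N n, μ[ξ N n | 𝒢 n] =ᵐ[μ] 0 := by
    intro N n
    have h1 := condExp_indicator (hDint n) (hA N n)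
    have h2 := condExp_smul (μ := μ) (a (n + 1)) (D (n + 2)) (ℱ (n + 1))
    have h3 := hD.condExp_eq_zero (n + 1) (by omega)
    filter_upwards [h1, h2, h3] with ω h1 h2 h3
    refine h1.trans ?_
    by_cases hω : ω ∈ A N n
    · rw [Set.indicator_of_mem hω]
      refine h2.trans ?_
      simp [h3]
    · rw [Set.indicator_of_notMem hω]
      rfl
  have hconv : ∀ᵐ ω ∂μ, ∀ N, ∃ l, Tendsto (fun n => ∑ i ∈ Finset.range n, ξ N i ω) atTop (𝓝 l) :=
    ae_all_iff.2 fun N => ae_exists_tendsto_sum_of_summable_variance (hsm N) (hL2 N) (hce N)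
      (Summable.of_nonneg_of_le (fun n => integral_nonneg fun ω => sq_nonneg _) (hvar N)
        (((summable_nat_add_iff 1).2 ha).mul_right _))
  filter_upwards [hconv, hV] with ω hω ⟨N, hN⟩
  obtain ⟨l, hl⟩ := hω N
  -- The first term is split off because no conditional mean is prescribed for `D 1`.
  refine ⟨l + a 0 * D 1 ω, (tendsto_add_atTop_iff_nat 1).1 ?_⟩
  refine (hl.add_const (a 0 * D 1 ω)).congr fun n => ?_
  rw [Finset.sum_range_succ']
  congr 1
  refine Finset.sum_congr rfl fun i _ => ?_
  have hmem : ω ∈ A N i := Set.mem_iInter₂.2 fun m hm => hN m (Finset.mem_Icc.1 hm).1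
  simp only [ξ, Set.indicator_of_mem hmem]

/-- The accumulated martingale noise converges almost surely when the square-summable step sizes
meet a conditional variance bound along bounded iterates. -/
theorem ae_exists_tendsto_noise {ι X Y Z : Type*} [Fintype ι] [NormedAddCommGroup X]
    [NormedAddCommGroup Y] [NormedAddCommGroup Z] {ℱ : Filtration ℕ mΩ}
    {M : ℕ → Ω → EuclideanSpace ℝ ι} (hM : IsMartingaleDifference M ℱ μ)
    {x : ℕ → Ω → X} {y : ℕ → Ω → Y} {z : ℕ → Ω → Z} {K : ℝ}
    (hK : HasConditionalVarianceBound M ℱ μ K x y z)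
    (hbdd : ∀ᵐ ω ∂μ, BddAbove (Set.range fun n => ‖x n ω‖ + ‖y n ω‖ + ‖z n ω‖))
    {a : ℕ → ℝ} (ha : Summable fun n => a n ^ 2) :
    ∀ᵐ ω ∂μ, ∃ l, Tendsto (fun n => ∑ i ∈ Finset.range n, a i • M (i + 1) ω) atTop (𝓝 l) := by
  -- Truncation is by the conditional variance itself, which is `ℱ n`-measurable; the iterates in
  -- its upper bound carry no measurability assumption.
  set V : ℕ → Ω → ENNReal := fun n =>
    condLExp (ℱ n) μ (fun ω' => ENNReal.ofReal (‖M (n + 1) ω'‖ ^ 2)) with hVdef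
  have hV : ∀ᵐ ω ∂μ, ∃ N : ℕ, ∀ n ≥ 1, V n ω ≤ N := by
    have hK' : ∀ᵐ ω ∂μ, ∀ n ≥ 1,
        V n ω ≤ ENNReal.ofReal (K * (1 + ‖x n ω‖ ^ 2 + ‖y n ω‖ ^ 2 + ‖z n ω‖ ^ 2)) := by
      rw [ae_all_iff]
      intro n
      by_cases hn : n ≥ 1
      · filter_upwards [hK n hn] with ω hω _ using hω
      · exact Eventually.of_forall fun ω h => absurd h hn
    filter_upwards [hK', hbdd] with ω hω ⟨B, hB⟩
    -- `K` may be negative, and the sum of the squared norms is at most the square `B ^ 2` of the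
    -- bound on their sum.
    obtain ⟨N, hN⟩ := exists_nat_ge (|K| * (1 + B ^ 2))
    refine ⟨N, fun n hn => (hω n hn).trans ?_⟩
    rw [← ENNReal.ofReal_natCast]
    refine ENNReal.ofReal_le_ofReal (le_trans ?_ hN)
    have hBn : ‖x n ω‖ + ‖y n ω‖ + ‖z n ω‖ ≤ B := hB (Set.mem_range_self n)
    have hx := norm_nonneg (x n ω)
    have hy := norm_nonneg (y n ω)
    have hz := norm_nonneg (z n ω)
    have hle : 1 + ‖x n ω‖ ^ 2 + ‖y n ω‖ ^ 2 + ‖z n ω‖ ^ 2 ≤ 1 + B ^ 2 := by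
      have := pow_le_pow_left₀ (by positivity) hBn 2
      nlinarith [mul_nonneg hx hy, mul_nonneg hx hz, mul_nonneg hy hz]
    exact mul_le_mul (le_abs_self K) hle (by positivity) (abs_nonneg K)
  have hcoord : ∀ i : ι, ∀ᵐ ω ∂μ, ∃ l,
      Tendsto (fun n => ∑ j ∈ Finset.range n, a j * M (j + 1) ω i) atTop (𝓝 l) := by
    intro i
    let π : EuclideanSpace ℝ ι →L[ℝ] ℝ := EuclideanSpace.proj i
    refine ae_exists_tendsto_sum_of_bounded_condVar (D := fun n ω => M n ω i) (V := V) ?_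
      (fun n => measurable_condLExp _ _ _) ?_ hV ha
    · refine ⟨fun n hn => π.continuous.comp_stronglyMeasurable (hM.stronglyMeasurable n hn),
        fun n hn => π.integrable_comp (hM.integrable n hn), fun n hn => ?_⟩
      have h1 := π.comp_condExp_comm (m := ℱ n) (hM.integrable (n + 1) (by omega))
      filter_upwards [h1, hM.condExp_eq_zero n hn] with ω h1 h2
      refine h1.symm.trans ?_
      simp [h2]
    · intro n _ s hs
      rw [hVdef, setLIntegral_condLExp (ℱ.le n) μ _ hs]
      refine lintegral_mono fun ω => ENNReal.ofReal_le_ofReal ?_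
      rw [← sq_abs, ← Real.norm_eq_abs]
      exact pow_le_pow_left₀ (norm_nonneg _) (PiLp.norm_apply_le (M (n + 1) ω) i) 2
  filter_upwards [ae_all_iff.2 hcoord] with ω hω
  choose l hl using hω
  refine ⟨WithLp.toLp 2 l, ?_⟩
  have hpi : Tendsto (fun n i => ∑ j ∈ Finset.range n, a j * M (j + 1) ω i) atTop (𝓝 l) :=
    tendsto_pi_nhds.2 hl
  refine (((PiLp.continuous_toLp 2 _).tendsto l).comp hpi).congr fun n => ?_
  ext i
  simp

end MartingaleNoise

/-! ### Separation of timescales -/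

/-- A bounded fast iterate tracks the equilibrium that is globally asymptotically stable when the
slow variable is frozen. -/
theorem tendsto_sub_equilibrium_of_recursion {X Q : Type*} [NormedAddCommGroup X]
    [NormedSpace ℝ X] [ProperSpace X] [NormedAddCommGroup Q] [NormedSpace ℝ Q] [ProperSpace Q]
    {F : X × Q → X} (hF : Continuous F) {lam : Q → X} (hlam : Continuous lam)
    (hstab : ∀ q, IsGloballyAsymptoticallyStable (fun u => F (u, q)) (lam q))
    {s : ℕ → ℝ} (hs : ∀ n, 0 < s n) (hs0 : Tendsto s atTop (𝓝 0))
    (hsum : Tendsto (fun n => ∑ i ∈ Finset.range n, s i) atTop atTop)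
    {x e m : ℕ → X} {q e' m' : ℕ → Q}
    (hx : ∀ n, x (n + 1) = x n + s n • (F (x n, q n) + e n) + m n)
    (hq : ∀ n, q (n + 1) = q n + s n • e' n + m' n)
    (he : Tendsto e atTop (𝓝 0)) (he' : Tendsto e' atTop (𝓝 0))
    (hm : ∃ l, Tendsto (fun n => ∑ i ∈ Finset.range n, m i) atTop (𝓝 l))
    (hm' : ∃ l, Tendsto (fun n => ∑ i ∈ Finset.range n, m' i) atTop (𝓝 l))
    {R : ℝ} (hxR : ∀ n, ‖x n‖ ≤ R) (hqR : ∀ n, ‖q n‖ ≤ R) :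
    Tendsto (fun n => x n - lam (q n)) atTop (𝓝 0) := by
  have hR : ∀ n, ‖(x n, q n)‖ ≤ R := fun n => norm_prod_le_iff.2 ⟨hxR n, hqR n⟩
  refine tendsto_zero_of_clusterPts (Φ := fun u : X × Q => u.1 - lam u.2) (by fun_prop) hR ?_
  intro φ p hφ hp
  obtain ⟨l, hl⟩ := hm
  obtain ⟨l', hl'⟩ := hm'
  -- The pair is a single recursion with field `(F, 0)`: its limiting solutions have a constant
  -- second component.
  obtain ⟨v, R', hv0, hvR, hv⟩ := exists_entire_solution_of_noisy_recursion
    (F := fun u : X × Q => (F u, (0 : Q))) (by fun_prop) hs hs0 hsum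
    (u := fun n => (x n, q n)) (e := fun n => (e n, e' n)) (m := fun n => (m n, m' n))
    (fun n => by
      ext
      · simp [hx]
      · simp [hq])
    (he.prodMk_nhds he')
    ⟨(l, l'), (hl.prodMk_nhds hl').congr fun n => by
      ext
      · simp [Prod.fst_sum]
      · simp [Prod.snd_sum]⟩ hR hφ hp
  have hv1 : ∀ t, HasDerivAt (fun t => (v t).1) (F (v t)) t := fun t => (hv t).fst
  have hv2 : ∀ t, HasDerivAt (fun t => (v t).2) 0 t := fun t => (hv t).snd
  have hconst : ∀ t, (v t).2 = p.2 := fun t => by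
    rw [← hv0]
    exact is_const_of_deriv_eq_zero (fun t => (hv2 t).differentiableAt)
      (fun t => (hv2 t).deriv) t 0
  have := (hstab p.2).eq_of_bounded_entire (by fun_prop) (v := fun t => (v t).1) (R := R')
    (fun t => (norm_fst_le _).trans (hvR t)) (fun t => by
      have := hv1 t
      rwa [show v t = ((v t).1, p.2) from Prod.ext rfl (hconst t)] at this)
  rw [hv0] at this
  exact sub_eq_zero.2 this

/-- Drifts that are bounded become negligible on a faster timescale. -/
theorem tendsto_div_smul_of_isLittleO {E : Type*} [NormedAddCommGroup E] [NormedSpace ℝ E]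
    {a b : ℕ → ℝ} (hba : b =o[atTop] a) {w : ℕ → E} {C : ℝ} (hw : ∀ n, ‖w n‖ ≤ C) :
    Tendsto (fun n => (b n / a n) • w n) atTop (𝓝 0) :=
  hba.tendsto_div_nhds_zero.zero_smul_isBoundedUnder_le
    (isBoundedUnder_of ⟨C, hw⟩)

/-- Pathwise convergence of three-timescale recursions whose accumulated noises converge. -/
theorem tendsto_of_three_timescale_recursion {X Y Z : Type*}
    [NormedAddCommGroup X] [NormedSpace ℝ X] [ProperSpace X]
    [NormedAddCommGroup Y] [NormedSpace ℝ Y] [ProperSpace Y]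
    [NormedAddCommGroup Z] [NormedSpace ℝ Z] [ProperSpace Z]
    {f : X × Y × Z → X} {g : X × Y × Z → Y} {h : X × Y × Z → Z}
    (hf : Continuous f) (hg : Continuous g) (hh : Continuous h)
    {a b c : ℕ → ℝ} (ha : ∀ n, 0 < a n) (hb : ∀ n, 0 < b n) (hc : ∀ n, 0 < c n)
    (ha0 : Tendsto a atTop (𝓝 0)) (hb0 : Tendsto b atTop (𝓝 0)) (hc0 : Tendsto c atTop (𝓝 0))
    (ha_sum : Tendsto (fun n => ∑ i ∈ Finset.range n, a i) atTop atTop)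
    (hb_sum : Tendsto (fun n => ∑ i ∈ Finset.range n, b i) atTop atTop)
    (hc_sum : Tendsto (fun n => ∑ i ∈ Finset.range n, c i) atTop atTop)
    (hba : b =o[atTop] a) (hcb : c =o[atTop] b)
    {x m₁ : ℕ → X} {y m₂ : ℕ → Y} {z m₃ : ℕ → Z}
    (hx : ∀ n, x (n + 1) = x n + a n • (f (x n, y n, z n) + m₁ n))
    (hy : ∀ n, y (n + 1) = y n + b n • (g (x n, y n, z n) + m₂ n))
    (hz : ∀ n, z (n + 1) = z n + c n • (h (x n, y n, z n) + m₃ n))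
    (hm₁ : ∃ l, Tendsto (fun n => ∑ i ∈ Finset.range n, a i • m₁ i) atTop (𝓝 l))
    (hm₂ : ∃ l, Tendsto (fun n => ∑ i ∈ Finset.range n, b i • m₂ i) atTop (𝓝 l))
    (hm₃ : ∃ l, Tendsto (fun n => ∑ i ∈ Finset.range n, c i • m₃ i) atTop (𝓝 l))
    {R : ℝ} (hxR : ∀ n, ‖x n‖ ≤ R) (hyR : ∀ n, ‖y n‖ ≤ R) (hzR : ∀ n, ‖z n‖ ≤ R)
    {lam₁ : Y × Z → X} {lam₂ : Z → Y} {zstar : Z}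
    (hlam₁ : Continuous lam₁) (hlam₂ : Continuous lam₂)
    (h_ode₁ : ∀ q, IsGloballyAsymptoticallyStable (fun u => f (u, q)) (lam₁ q))
    (h_ode₂ : ∀ r, IsGloballyAsymptoticallyStable (fun v => g (lam₁ (v, r), v, r)) (lam₂ r))
    (h_ode₃ : IsGloballyAsymptoticallyStable
      (fun w => h (lam₁ (lam₂ w, w), lam₂ w, w)) zstar) :
    Tendsto (fun n => (x n, y n, z n)) atTop
      (𝓝 (lam₁ (lam₂ zstar, zstar), lam₂ zstar, zstar)) := by
  have hR : ∀ n, ‖(x n, y n, z n)‖ ≤ R := fun n =>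
    norm_prod_le_iff.2 ⟨hxR n, norm_prod_le_iff.2 ⟨hyR n, hzR n⟩⟩
  have hball : IsCompact (Metric.closedBall (0 : X × Y × Z) R) := isCompact_closedBall 0 R
  obtain ⟨Cg, hCg⟩ := hball.exists_bound_of_continuousOn hg.continuousOn
  obtain ⟨Ch, hCh⟩ := hball.exists_bound_of_continuousOn hh.continuousOn
  have hgb : ∀ n, ‖g (x n, y n, z n)‖ ≤ Cg := fun n => hCg _ (by simpa using hR n)
  have hhb : ∀ n, ‖h (x n, y n, z n)‖ ≤ Ch := fun n => hCh _ (by simpa using hR n)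
  obtain ⟨l₂, hl₂⟩ := hm₂
  obtain ⟨l₃, hl₃⟩ := hm₃
  have hfast : Tendsto (fun n => x n - lam₁ (y n, z n)) atTop (𝓝 0) := by
    refine tendsto_sub_equilibrium_of_recursion hf hlam₁ h_ode₁ ha ha0 ha_sum
      (e := fun _ => 0) (m := fun n => a n • m₁ n)
      (q := fun n => (y n, z n))
      -- The slow updates rewritten with step `a n`: their bounded drifts acquire the vanishing
      -- factors `b n / a n` and `c n / a n`.
      (e' := fun n => ((b n / a n) • g (x n, y n, z n), (c n / a n) • h (x n, y n, z n)))
      (m' := fun n => (b n • m₂ n, c n • m₃ n)) (fun n => ?_) (fun n => ?_) tendsto_const_nhds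
      ((tendsto_div_smul_of_isLittleO hba hgb).prodMk_nhds
        (tendsto_div_smul_of_isLittleO (hcb.trans hba) hhb))
      hm₁ ⟨(l₂, l₃), (hl₂.prodMk_nhds hl₃).congr fun n => ?_⟩ hxR
      (fun n => norm_prod_le_iff.2 ⟨hyR n, hzR n⟩)
    · rw [hx, add_zero, smul_add, add_assoc]
    · ext1
      · simp [hy, smul_smul, mul_div_cancel₀ _ (ha n).ne', add_assoc]
      · simp [hz, smul_smul, mul_div_cancel₀ _ (ha n).ne', add_assoc]
    · ext1
      · simp [Prod.fst_sum]
      · simp [Prod.snd_sum]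
  have hmid : Tendsto (fun n => y n - lam₂ (z n)) atTop (𝓝 0) := by
    refine tendsto_sub_equilibrium_of_recursion
      (F := fun u : Y × Z => g (lam₁ u, u)) (by fun_prop) hlam₂ h_ode₂ hb hb0 hb_sum
      -- The error of replacing `x n` by its tracked value `lam₁ (y n, z n)`, null by `hfast`.
      (e := fun n => g (x n, y n, z n) - g (lam₁ (y n, z n), y n, z n))
      (m := fun n => b n • m₂ n)
      (e' := fun n => (c n / b n) • h (x n, y n, z n)) (m' := fun n => c n • m₃ n)
      (fun n => ?_) (fun n => ?_) ?_ (tendsto_div_smul_of_isLittleO hcb hhb) ⟨l₂, hl₂⟩ ⟨l₃, hl₃⟩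
      hyR hzR
    · rw [hy, add_sub_cancel, smul_add, add_assoc]
    · rw [hz, smul_smul, mul_div_cancel₀ _ (hb n).ne', smul_add, add_assoc]
    · refine tendsto_map_sub_map_of_bounded hg (w := fun n => (lam₁ (y n, z n), y n, z n)) hR ?_
      simpa [Prod.zero_eq_mk] using hfast.prodMk_nhds
        (tendsto_const_nhds (x := (0 : Y × Z)))
  have hmid' : Tendsto (fun n => lam₁ (y n, z n) - lam₁ (lam₂ (z n), z n)) atTop (𝓝 0) := by
    refine tendsto_map_sub_map_of_bounded hlam₁ (w := fun n => (lam₂ (z n), z n))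
      (fun n => norm_prod_le_iff.2 ⟨hyR n, hzR n⟩) ?_
    simpa [Prod.zero_eq_mk] using hmid.prodMk_nhds (tendsto_const_nhds (x := (0 : Z)))
  have hfast' : Tendsto (fun n => x n - lam₁ (lam₂ (z n), z n)) atTop (𝓝 0) := by
    simpa using hfast.add hmid'
  have hslow : Tendsto (fun n => z n - zstar) atTop (𝓝 0) := by
    -- On the slowest clock no variable is left to freeze, so the parameter space is a point.
    refine tendsto_sub_equilibrium_of_recursion (Q := Unit)
      (F := fun u : Z × Unit => h (lam₁ (lam₂ u.1, u.1), lam₂ u.1, u.1)) (by fun_prop)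
      (lam := fun _ => zstar) continuous_const (fun _ => h_ode₃) hc hc0 hc_sum
      (e := fun n => h (x n, y n, z n) - h (lam₁ (lam₂ (z n), z n), lam₂ (z n), z n))
      (m := fun n => c n • m₃ n) (q := fun _ => 0) (e' := fun _ => 0) (m' := fun _ => 0)
      (fun n => ?_) (fun n => by simp) ?_ tendsto_const_nhds ⟨l₃, hl₃⟩ ⟨0, by simp⟩ hzR
      (fun n => by simpa using (norm_nonneg _).trans (hzR n))
    · rw [hz, add_sub_cancel, smul_add, add_assoc]
    · refine tendsto_map_sub_map_of_bounded hh
        (w := fun n => (lam₁ (lam₂ (z n), z n), lam₂ (z n), z n)) hR ?_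
      simpa [Prod.zero_eq_mk] using hfast'.prodMk_nhds
        (hmid.prodMk_nhds (tendsto_const_nhds (x := (0 : Z))))
  have hzlim : Tendsto z atTop (𝓝 zstar) := tendsto_sub_nhds_zero_iff.1 hslow
  have hylim : Tendsto y atTop (𝓝 (lam₂ zstar)) := by
    simpa using hmid.add ((hlam₂.tendsto zstar).comp hzlim)
  have hxlim : Tendsto x atTop (𝓝 (lam₁ (lam₂ zstar, zstar))) := by
    simpa using hfast.add ((hlam₁.tendsto _).comp (hylim.prodMk_nhds hzlim))
  exact hxlim.prodMk_nhds (hylim.prodMk_nhds hzlim)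

/-! ### Reduction to a single sample path -/

theorem mainTheorem2 {Ω : Type*} {mΩ : MeasurableSpace Ω} (μ : Measure Ω) [IsProbabilityMeasure μ]
    (d k p : ℕ)
    -- drifts
    (f : EuclideanSpace ℝ (Fin d) × EuclideanSpace ℝ (Fin k) × EuclideanSpace ℝ (Fin p) →
      EuclideanSpace ℝ (Fin d))
    (g : EuclideanSpace ℝ (Fin d) × EuclideanSpace ℝ (Fin k) × EuclideanSpace ℝ (Fin p) →
      EuclideanSpace ℝ (Fin k))
    (h : EuclideanSpace ℝ (Fin d) × EuclideanSpace ℝ (Fin k) × EuclideanSpace ℝ (Fin p) →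
      EuclideanSpace ℝ (Fin p))
    (hf : ∃ L, LipschitzWith L f) (hg : ∃ L, LipschitzWith L g)
    (hh : Continuous h) (hh_growth : ∃ C : ℝ, ∀ u, ‖h u‖ ≤ C * (1 + ‖u‖))
    -- stepsizes
    (a b c : ℕ → ℝ)
    (ha_pos : ∀ n, 0 < a n) (hb_pos : ∀ n, 0 < b n) (hc_pos : ∀ n, 0 < c n)
    (ha_sum : Tendsto (fun n => ∑ i ∈ Finset.range n, a i) atTop atTop)
    (hb_sum : Tendsto (fun n => ∑ i ∈ Finset.range n, b i) atTop atTop)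
    (hc_sum : Tendsto (fun n => ∑ i ∈ Finset.range n, c i) atTop atTop)
    (h_sq : Summable (fun n => a n ^ 2 + b n ^ 2 + c n ^ 2))
    (hba : b =o[atTop] a) (hcb : c =o[atTop] b)
    -- noise
    (ℱ : Filtration ℕ mΩ)
    (M₁ : ℕ → Ω → EuclideanSpace ℝ (Fin d))
    (M₂ : ℕ → Ω → EuclideanSpace ℝ (Fin k))
    (M₃ : ℕ → Ω → EuclideanSpace ℝ (Fin p))
    (hM₁ : IsMartingaleDifference M₁ ℱ μ)
    (hM₂ : IsMartingaleDifference M₂ ℱ μ)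
    (hM₃ : IsMartingaleDifference M₃ ℱ μ)
    -- iterates
    (x : ℕ → Ω → EuclideanSpace ℝ (Fin d))
    (y : ℕ → Ω → EuclideanSpace ℝ (Fin k))
    (z : ℕ → Ω → EuclideanSpace ℝ (Fin p))
    (hx : ∀ n, ∀ᵐ ω ∂μ, x (n + 1) ω = x n ω + a n • (f (x n ω, y n ω, z n ω) + M₁ (n + 1) ω))
    (hy : ∀ n, ∀ᵐ ω ∂μ, y (n + 1) ω = y n ω + b n • (g (x n ω, y n ω, z n ω) + M₂ (n + 1) ω))
    (hz : ∀ n, ∀ᵐ ω ∂μ, z (n + 1) ω = z n ω + c n • (h (x n ω, y n ω, z n ω) + M₃ (n + 1) ω))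
    (K : ℝ)
    (hK₁ : HasConditionalVarianceBound M₁ ℱ μ K x y z)
    (hK₂ : HasConditionalVarianceBound M₂ ℱ μ K x y z)
    (hK₃ : HasConditionalVarianceBound M₃ ℱ μ K x y z)
    (h_bdd : ∀ᵐ ω ∂μ, BddAbove (Set.range fun n => ‖x n ω‖ + ‖y n ω‖ + ‖z n ω‖))
    -- nested differential equations
    (lam₁ : EuclideanSpace ℝ (Fin k) × EuclideanSpace ℝ (Fin p) → EuclideanSpace ℝ (Fin d))
    (lam₂ : EuclideanSpace ℝ (Fin p) → EuclideanSpace ℝ (Fin k))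
    (zstar : EuclideanSpace ℝ (Fin p))
    (hlam₁ : ∃ L, LipschitzWith L lam₁) (hlam₂ : ∃ L, LipschitzWith L lam₂)
    (h_ode₁ : ∀ y₀ z₀, IsGloballyAsymptoticallyStable (fun u => f (u, y₀, z₀)) (lam₁ (y₀, z₀)))
    (h_ode₂ : ∀ z₀, IsGloballyAsymptoticallyStable (fun v => g (lam₁ (v, z₀), v, z₀)) (lam₂ z₀))
    (h_ode₃ : IsGloballyAsymptoticallyStable
      (fun w => h (lam₁ (lam₂ w, w), lam₂ w, w)) zstar) :
    ∀ᵐ ω ∂μ, Tendsto (fun n => (x n ω, y n ω, z n ω)) atTop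
      (𝓝 (lam₁ (lam₂ zstar, zstar), lam₂ zstar, zstar)) := by
  obtain ⟨_, hf⟩ := hf
  obtain ⟨_, hg⟩ := hg
  obtain ⟨_, hlam₁⟩ := hlam₁
  obtain ⟨_, hlam₂⟩ := hlam₂
  have ha_sq : Summable fun n => a n ^ 2 :=
    h_sq.of_nonneg_of_le (fun n => sq_nonneg _) fun n => by
      nlinarith [sq_nonneg (b n), sq_nonneg (c n)]
  have hb_sq : Summable fun n => b n ^ 2 :=
    h_sq.of_nonneg_of_le (fun n => sq_nonneg _) fun n => by
      nlinarith [sq_nonneg (a n), sq_nonneg (c n)]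
  have hc_sq : Summable fun n => c n ^ 2 :=
    h_sq.of_nonneg_of_le (fun n => sq_nonneg _) fun n => by
      nlinarith [sq_nonneg (a n), sq_nonneg (b n)]
  have tendsto_zero_of_sq : ∀ s : ℕ → ℝ, (Summable fun n => s n ^ 2) →
      Tendsto s atTop (𝓝 0) := fun s hs => by
    rw [tendsto_zero_iff_abs_tendsto_zero]
    simpa [Function.comp_def, Real.sqrt_sq_eq_abs] using
      (Real.continuous_sqrt.tendsto 0).comp hs.tendsto_atTop_zero
  filter_upwards [ae_all_iff.2 hx, ae_all_iff.2 hy, ae_all_iff.2 hz, h_bdd,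
    ae_exists_tendsto_noise hM₁ hK₁ h_bdd ha_sq, ae_exists_tendsto_noise hM₂ hK₂ h_bdd hb_sq,
    ae_exists_tendsto_noise hM₃ hK₃ h_bdd hc_sq] with ω hx hy hz ⟨R, hR⟩ hm₁ hm₂ hm₃
  have hR' : ∀ n, ‖x n ω‖ + ‖y n ω‖ + ‖z n ω‖ ≤ R := fun n => hR (Set.mem_range_self n)
  exact tendsto_of_three_timescale_recursion hf.continuous hg.continuous hh ha_pos hb_pos hc_pos
    (tendsto_zero_of_sq a ha_sq) (tendsto_zero_of_sq b hb_sq) (tendsto_zero_of_sq c hc_sq)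
    ha_sum hb_sum hc_sum hba hcb hx hy hz hm₁ hm₂ hm₃ (R := R)
    (fun n => by linarith [hR' n, norm_nonneg (y n ω), norm_nonneg (z n ω)])
    (fun n => by linarith [hR' n, norm_nonneg (x n ω), norm_nonneg (z n ω)])
    (fun n => by linarith [hR' n, norm_nonneg (x n ω), norm_nonneg (y n ω)])
    hlam₁.continuous hlam₂.continuous (fun q => h_ode₁ q.1 q.2) h_ode₂ h_ode₃
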